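/- Let $S$ be a countable scattered chain of finite Hausdorff rank with bounded finite sums. Then $S$ has finite big Ramsey spectrum, that is, $T(n,S)<\infty$ for every integer $n\ge 1$. The notions are as follows. A chain is a strict linear order; $A\hookrightarrow B$ means that there is an order embedding of $A$ into $B$, and $A\equiv B$ means $A\hookrightarrow B$ and $B\hookrightarrow A$. The sum $\sum_{a\in A}B_a$ of chains is $\bigcup_{a\in A}\{a\}\times B_a$ ordered lexicographically. A chain $S$ is scattered if $\mathbb{Q}\not\hookrightarrow S$. *Hausdorff rank.* Up to isomorphism, let $\mathcal H_0$ consist of the empty chain and the one-element chain and, for an ordinal $\alpha>0$, let $\mathcal H_\alpha$ consist of all sums $\sum_{i\in\mathbb Z}S_i$ with $S_i\in\bigcup_{\beta<\alpha}\mathcal H_\beta$ for all $i$. The Hausdorff rank $r_H(S)$ of a countable scattered chain $S$ is the least $\alpha$ with $S\in\mathcal H_\alpha$; it is finite if $r_H(S)<\omega$. *Trees.* We consider labelled ordered rooted trees, up to isomorphism, with vertex labels from $\{0,1,+,\omega,\omega^*\}$ and edge labels from $\omega\cup\{\iota_n:n\in\omega\}$, and the chains $\|\tau\|$ that they encode.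 The single-vertex trees $\bullet0$ and $\bullet1$, labelled by $0$ and $1$, encode the empty chain and the one-element chain. The tree $\tau_0+\dots+\tau_n$ has a root labelled by $+$, whose outgoing edges are labelled by and ordered as $\iota_0,\dots,\iota_n$, the edge $\iota_j$ leading to $\tau_j$; it encodes $\|\tau_0\|+\dots+\|\tau_n\|$. The tree $\sum_{k\in\omega}\tau_k$ (resp. $\sum_{k\in\omega^*}\tau_k$) has a root labelled by $\omega$ (resp. $\omega^*$), whose outgoing edges are labelled by and ordered as $\omega$ (resp. $\omega^*$), the edge $k$ leading to $\tau_k$; it encodes $\sum_{k\in\omega}\|\tau_k\|$ (resp. $\sum_{k\in\omega^*}\|\tau_k\|$). Let $\mathcal A_0=\{\bullet0,\bullet1\}$ and, for $m\ge1$, let $\mathcal A_m$ consist of - all trees $\sum_{k\in\omega}\tau_k$ and $\sum_{k\in\omega^*}\tau_k$ with $\tau_k\in\bigcup_{i<m}\mathcal A_i$ and $\|\tau_0\|\hookrightarrow\|\tau_1\|\hookrightarrow\cdots$; - all trees $\sum_{k\in\omega}(\tau_{k0}+\dots+\tau_{kn})$ and $\sum_{k\in\omega^*}(\tau_{k0}+\dots+\tau_{kn})$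 with $n\ge1$, $\tau_{kj}\in\bigcup_{i<m}\mathcal A_i$ and $\|\tau_{0j}\|\hookrightarrow\|\tau_{1j}\|\hookrightarrow\cdots$ for all $0\le j\le n$. Let $\mathcal A=\bigcup_{m\in\omega}\mathcal A_m$ and $\mathcal S=\mathcal A\cup\{\tau_0+\dots+\tau_n : n\ge1,\ \tau_0,\dots,\tau_n\in\mathcal A\}$. A tree $\sigma\in\mathcal S$ has bounded finite sums if there is an integer $w$ such that all edge labels of $\sigma$ belong to $\omega\cup\{\iota_0,\dots,\iota_w\}$. The chain $S$ has bounded finite sums if $S\equiv\|\sigma\|$ for some $\sigma\in\mathcal S$ with bounded finite sums. *Big Ramsey degrees.* For an integer $n\ge1$ and a chain $C$ let $\mathrm{Emb}(n,C)$ be the set of embeddings of the $n$-element chain into $C$. Then $T(n,C)$ is the least positive integer $t$ such that for every $k\ge2$ and every coloring $\chi:\mathrm{Emb}(n,C)\to\{0,\dots,k-1\}$ there is an embedding $w:C\hookrightarrow C$ with $|\chi(\{w\circ f: f\in\mathrm{Emb}(n,C)\})|\le t$; if there is no such $t$, then $T(n,C)=\infty$. -/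

import Mathlib

namespace ScatteredChain

universe u v

/-! ## Chains, embeddability, scatteredness -/

/-- A chain is scattered if the chain of rationals does not embed into it. -/
def IsScattered (S : Type u) [LinearOrder S] : Prop :=
  IsEmpty (ℚ ↪o S)

/-- Embeddability of chains. -/
def Embeds (A : Type u) (B : Type v) [LinearOrder A] [LinearOrder B] : Prop :=
  Nonempty (A ↪o B)

/-- Bi-embeddability of chains. -/
def BiEmbeds (A : Type u) (B : Type v) [LinearOrder A] [LinearOrder B] : Prop :=
  Embeds A B ∧ Embeds B A

/-! ## Hausdorff rank -/

/-- `InHausdorffClass α S`: up to isomorphism, the chain `S` belongs to the `α`-th Hausdorff class.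
The class of index `0` consists of the empty and the one-element chain; for `α > 0` the class
consists of all lexicographic sums over `ℤ` of chains from classes with indices below `α`.
In the last constructor `α > 0` is automatic. -/
inductive InHausdorffClass : Ordinal.{0} → (S : Type u) → [LinearOrder S] → Prop
  | empty (S : Type u) [LinearOrder S] (e : S ≃o Fin 0) : InHausdorffClass 0 S
  | single (S : Type u) [LinearOrder S] (e : S ≃o Fin 1) : InHausdorffClass 0 S
  | sum (α : Ordinal.{0}) (S : Type u) [LinearOrder S]
      (R : ℤ → Type u) [∀ i, LinearOrder (R i)] (β : ℤ → Ordinal.{0})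
      (hβ : ∀ i, β i < α) (hR : ∀ i, InHausdorffClass (β i) (R i))
      (e : S ≃o Σₗ i, R i) : InHausdorffClass α S

/-- The Hausdorff rank of a chain: the least `α` such that the chain is in the `α`-th Hausdorff
class (and `⊤` if there is no such `α`, that is, if the chain is uncountable or not scattered). -/
noncomputable def hausdorffRank (S : Type u) [LinearOrder S] : WithTop Ordinal.{0} :=
  sInf ((fun α : Ordinal.{0} => (α : WithTop Ordinal.{0})) '' {α | InHausdorffClass α S})

/-! ## Trees and the chains they encode -/

/-- Labelled ordered rooted trees up to isomorphism, as they are built from single vertices: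
* `zero`, `one`: a single vertex labelled by `0`, `1`;
* `plus n τ`: the tree `τ 0 + ⋯ + τ n`, with root labelled by `+` and outgoing edges labelled by
  (and ordered as) `ι₀, …, ιₙ`, where `ιⱼ` leads to `τ j`;
* `omega τ`, `omegaStar τ`: the tree with root labelled by `ω` (by `ω*`) and outgoing edges
  labelled by the natural numbers and ordered as `ω` (as `ω*`), where `k` leads to `τ k`. -/
inductive ChainTree : Type
  | zero : ChainTree
  | one : ChainTree
  | plus (n : ℕ) (τ : Fin (n + 1) → ChainTree) : ChainTree
  | omega (τ : ℕ → ChainTree) : ChainTree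
  | omegaStar (τ : ℕ → ChainTree) : ChainTree

/-- The labels of edges: natural numbers and the formal symbols `ι₀, ι₁, …`. -/
inductive EdgeLabel : Type
  | num (k : ℕ) : EdgeLabel
  | iota (j : ℕ) : EdgeLabel

namespace ChainTree

/-- The underlying set of the chain encoded by a tree. -/
def Chain : ChainTree → Type
  | zero => Fin 0
  | one => Fin 1
  | plus n τ => Σₗ j : Fin (n + 1), (τ j).Chain
  | omega τ => Σₗ k : ℕ, (τ k).Chain
  | omegaStar τ => Σₗ k : ℕᵒᵈ, (τ (OrderDual.ofDual k)).Chain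

/-- The linear order of the chain encoded by a tree: sums are ordered lexicographically. -/
noncomputable instance instLinearOrderChain : (τ : ChainTree) → LinearOrder τ.Chain
  | zero => inferInstanceAs (LinearOrder (Fin 0))
  | one => inferInstanceAs (LinearOrder (Fin 1))
  | plus _ τ =>
      @Sigma.Lex.linearOrder _ (fun j => (τ j).Chain) _ fun j => instLinearOrderChain (τ j)
  | omega τ =>
      @Sigma.Lex.linearOrder ℕ (fun k => (τ k).Chain) _ fun k => instLinearOrderChain (τ k)
  | omegaStar τ =>
      @Sigma.Lex.linearOrder ℕᵒᵈ (fun k => (τ (OrderDual.ofDual k)).Chain) _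
        fun k => instLinearOrderChain (τ (OrderDual.ofDual k))

/-- The set of the edge labels that appear in a tree. -/
def edgeLabels : ChainTree → Set EdgeLabel
  | zero => ∅
  | one => ∅
  | plus n τ =>
      Set.range (fun j : Fin (n + 1) => EdgeLabel.iota (j : ℕ)) ∪ ⋃ j, (τ j).edgeLabels
  | omega τ => Set.range EdgeLabel.num ∪ ⋃ k, (τ k).edgeLabels
  | omegaStar τ => Set.range EdgeLabel.num ∪ ⋃ k, (τ k).edgeLabels

/-- A tree has bounded finite sums if for some `w` all its edge labels are natural numbers or
among `ι₀, …, ι_w`. -/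
def HasBoundedFiniteSums (σ : ChainTree) : Prop :=
  ∃ w : ℕ, σ.edgeLabels ⊆ Set.range EdgeLabel.num ∪ EdgeLabel.iota '' Set.Iic w

end ChainTree

open ChainTree

/-- `InA m τ`: the tree `τ` is in the class `𝒜ₘ`. For `m > 0` this means that, for some sequence of
trees `τ k` or of tuples of trees `τ k 0, …, τ k n` with a fixed `n ≥ 1`, all from
`𝒜₀ ∪ ⋯ ∪ 𝒜ₘ₋₁` and encoding chains that are increasing in `k` with respect to embeddability, the
given tree is the sum of the `τ k`, or of the `τ k 0 + ⋯ + τ k n`, over `ω` or `ω*`. -/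
inductive InA : ℕ → ChainTree → Prop
  | zero : InA 0 zero
  | one : InA 0 one
  | omega (m : ℕ) (τ : ℕ → ChainTree) (i : ℕ → ℕ)
      (hi : ∀ k, i k < m) (hτ : ∀ k, InA (i k) (τ k))
      (hmono : ∀ k, Embeds (τ k).Chain (τ (k + 1)).Chain) :
      InA m (omega τ)
  | omegaStar (m : ℕ) (τ : ℕ → ChainTree) (i : ℕ → ℕ)
      (hi : ∀ k, i k < m) (hτ : ∀ k, InA (i k) (τ k))
      (hmono : ∀ k, Embeds (τ k).Chain (τ (k + 1)).Chain) :
      InA m (omegaStar τ)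
  | omegaPlus (m n : ℕ) (hn : 1 ≤ n) (τ : ℕ → Fin (n + 1) → ChainTree) (i : ℕ → Fin (n + 1) → ℕ)
      (hi : ∀ k j, i k j < m) (hτ : ∀ k j, InA (i k j) (τ k j))
      (hmono : ∀ j k, Embeds (τ k j).Chain (τ (k + 1) j).Chain) :
      InA m (omega fun k => plus n (τ k))
  | omegaStarPlus (m n : ℕ) (hn : 1 ≤ n)
      (τ : ℕ → Fin (n + 1) → ChainTree) (i : ℕ → Fin (n + 1) → ℕ)
      (hi : ∀ k j, i k j < m) (hτ : ∀ k j, InA (i k j) (τ k j))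
      (hmono : ∀ j k, Embeds (τ k j).Chain (τ (k + 1) j).Chain) :
      InA m (omegaStar fun k => plus n (τ k))

/-- The class `𝒜` is the union of the classes `𝒜ₘ`. -/
def treesA : Set ChainTree :=
  {τ | ∃ m, InA m τ}

/-- The class `𝒮` consists of the trees from `𝒜` and of their finite sums. -/
def treesS : Set ChainTree :=
  treesA ∪ {σ | ∃ (n : ℕ) (τ : Fin (n + 1) → ChainTree),
    1 ≤ n ∧ (∀ j, τ j ∈ treesA) ∧ σ = plus n τ}

/-- A chain has bounded finite sums if it is bi-embeddable with the chain encoded by some tree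
from `𝒮` with bounded finite sums. -/
def HasBoundedFiniteSums (S : Type u) [LinearOrder S] : Prop :=
  ∃ σ ∈ treesS, σ.HasBoundedFiniteSums ∧ BiEmbeds S σ.Chain

/-! ## Big Ramsey degrees -/

/-- The partition relation `C ⟶ (B)^A_{k,t}`: for every `k`-coloring of the embeddings of `A` into
`C` there is an embedding `w` of `B` into `C` such that at most `t` colors are attained on the
composites of `w` with the embeddings of `A` into `B`. -/
def Arrow (C : Type u) (B : Type u) (A : Type v) [LinearOrder C] [LinearOrder B] [LinearOrder A]
    (k t : ℕ) : Prop :=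
  ∀ χ : (A ↪o C) → Fin k, ∃ w : B ↪o C,
    (χ '' Set.range fun f : A ↪o B => f.trans w).encard ≤ t

/-- The big Ramsey degree `T(n, C)` of the `n`-element chain in `C`: the least positive integer `t`
such that `C ⟶ (C)^n_{k,t}` for all `k ≥ 2`, and `⊤` if there is no such `t`. -/
noncomputable def bigRamseyDegree (n : ℕ) (C : Type u) [LinearOrder C] : ℕ∞ :=
  sInf ((fun t : ℕ => (t : ℕ∞)) '' {t | 1 ≤ t ∧ ∀ k, 2 ≤ k → Arrow C C (Fin n) k t})

/-- The big Ramsey spectrum `(T(1, C), T(2, C), T(3, C), …)`. -/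
noncomputable def bigRamseySpectrum (C : Type u) [LinearOrder C] : ℕ+ → ℕ∞ :=
  fun n => bigRamseyDegree n C

/-- The big Ramsey spectrum is finite if all its entries are finite. -/
def HasFiniteBigRamseySpectrum (C : Type u) [LinearOrder C] : Prop :=
  ∀ n : ℕ+, bigRamseySpectrum C n < ⊤

end ScatteredChain

/-! An element of the chain of a tree `σ` is determined by the edge labels on its path from the
root. For `σ` in `treesS` with bounded finite sums, paths have length at most some `L` and use only
finitely many labels `ι_j`, so an `n`-tuple of paths is given by an `n * L`-element set of numbers
and one of finitely many patterns saying where these numbers and the `ι_j` stand. Color each such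
set by the function taking a pattern to the color of the embedding it describes. Ramsey's theorem
yields an infinite `M` on whose subsets the color depends on the pattern alone. Since summands
increase under embeddability, `σ` embeds into itself through paths with numbers from `M`
(`embedsWithin_of_mem_treesS`), and on this copy there are at most as many colors as patterns.
Bi-embeddability carries the bound over to `S`. -/

/-- The infinite Ramsey theorem for colorings of `N`-element sets of natural numbers by finitely
many colors, inside a prescribed infinite set. -/
theorem Set.Infinite.exists_homogeneous {κ : Type*} [Finite κ] (N : ℕ) :
    ∀ (χ : Finset ℕ → κ) {A : Set ℕ}, A.Infinite →
      ∃ M ⊆ A, M.Infinite ∧ ∃ c, ∀ s : Finset ℕ, ↑s ⊆ M → s.card = N → χ s = c := by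
  induction N with
  | zero =>
    intro χ A hA
    refine ⟨A, subset_rfl, hA, χ ∅, fun s _ hs => ?_⟩
    rw [Finset.card_eq_zero.mp hs]
  | succ N ih =>
    intro χ A hA
    -- Passing to `B'` makes the color of `insert (sInf B) s` independent of `s`. After iteration,
    -- the color of a set of the chosen minima depends only on its least element.
    have step : ∀ B : {B : Set ℕ // B.Infinite}, ∃ B' : {B : Set ℕ // B.Infinite}, ∃ c,
        B'.1 ⊆ B.1 ∩ Set.Ioi (sInf B.1) ∧ ∀ s : Finset ℕ, ↑s ⊆ B'.1 → s.card = N →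
          χ (insert (sInf B.1) s) = c := by
      rintro ⟨B, hB⟩
      have hB' : (B ∩ Set.Ioi (sInf B)).Infinite := by
        refine (hB.sdiff (Set.finite_Iic (sInf B))).mono fun x hx => ⟨hx.1, ?_⟩
        simpa using hx.2
      obtain ⟨M, hM, hMi, c, hc⟩ := ih (fun s => χ (insert (sInf B) s)) hB'
      exact ⟨⟨M, hMi⟩, c, hM, hc⟩
    choose next color hnext hcolor using step
    let B : ℕ → {B : Set ℕ // B.Infinite} := fun i => next^[i] ⟨A, hA⟩
    have hB : ∀ i, B (i + 1) = next (B i) := fun i => Function.iterate_succ_apply' _ _ _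
    let a : ℕ → ℕ := fun i => sInf (B i).1
    have ha : ∀ i, a i ∈ (B i).1 := fun i => Nat.sInf_mem (B i).2.nonempty
    have hsub : ∀ i, (B (i + 1)).1 ⊆ (B i).1 ∩ Set.Ioi (a i) := fun i => by
      rw [hB]; exact hnext _
    have hanti : Antitone fun i => (B i).1 :=
      antitone_nat_of_succ_le fun i => (hsub i).trans Set.inter_subset_left
    have hmono : StrictMono a := strictMono_nat_of_lt_succ fun i => (hsub i (ha _)).2
    -- Pigeonhole: infinitely many minima share their color.
    obtain ⟨c, hc⟩ := Finite.exists_infinite_fiber fun i => color (B i)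
    refine ⟨a '' ((fun i => color (B i)) ⁻¹' {c}), ?_,
      (Set.infinite_coe_iff.mp hc).image hmono.injective.injOn, c, fun s hs hcard => ?_⟩
    · rintro _ ⟨i, -, rfl⟩
      exact hanti (Nat.zero_le i) (ha i)
    · have hne : s.Nonempty := Finset.card_pos.mp (by omega)
      obtain ⟨i, hi, hia⟩ := hs (s.min'_mem hne)
      have his : a i ∈ s := hia ▸ s.min'_mem hne
      have key := hcolor (B i) (s.erase (a i)) (fun x hx => by
        have hx : x ≠ a i ∧ x ∈ s := Finset.mem_erase.mp hx
        obtain ⟨j, -, rfl⟩ := hs hx.2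
        have hlt : a i < a j := lt_of_le_of_ne (hia ▸ s.min'_le _ hx.2) hx.1.symm
        rw [← hB]
        exact hanti (hmono.lt_iff_lt.mp hlt) (ha j))
        (by rw [Finset.card_erase_of_mem his, hcard]; rfl)
      rw [Finset.insert_erase his] at key
      exact key.trans hi

/-- Embeddings of the summands over an embedding of the index chains induce an embedding of the
lexicographic sums. -/
def OrderEmbedding.sigmaLexMap {ι κ : Type*} [LinearOrder ι] [LinearOrder κ] {α : ι → Type*}
    {β : κ → Type*} [∀ i, LinearOrder (α i)] [∀ k, LinearOrder (β k)] (e : ι ↪o κ)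
    (φ : ∀ i, α i ↪o β (e i)) : (Σₗ i, α i) ↪o Σₗ k, β k :=
  OrderEmbedding.ofStrictMono (fun x => toLex ⟨e (ofLex x).1, φ _ (ofLex x).2⟩) <| by
    rintro ⟨i, x⟩ ⟨j, y⟩ h
    rcases Sigma.Lex.lt_def.mp h with h | ⟨h, h'⟩
    · exact Sigma.Lex.lt_def.mpr (Or.inl (e.lt_iff_lt.mpr h))
    · dsimp only at h
      subst h
      exact Sigma.Lex.lt_def.mpr (Or.inr ⟨rfl, (φ i).lt_iff_lt.mpr h'⟩)

namespace ScatteredChain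

open ChainTree

theorem Embeds.trans {A B C : Type*} [LinearOrder A] [LinearOrder B] [LinearOrder C]
    (h : Embeds A B) (h' : Embeds B C) : Embeds A C :=
  ⟨h.some.trans h'.some⟩

theorem embeds_of_le {τ : ℕ → ChainTree} (h : ∀ k, Embeds (τ k).Chain (τ (k + 1)).Chain)
    {k l : ℕ} (hkl : k ≤ l) : Embeds (τ k).Chain (τ l).Chain := by
  induction l, hkl using Nat.le_induction with
  | base => exact ⟨RelEmbedding.refl _⟩
  | succ l _ ih => exact ih.trans (h l)

/-! ### Coding elements by paths -/

namespace ChainTree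

/-- The labels of the edges on the path from the root to the leaf that represents a given element
of the chain. -/
def path : (τ : ChainTree) → τ.Chain → List EdgeLabel
  | zero, _ => []
  | one, _ => []
  | plus _ τ, x => .iota (ofLex x).1 :: (τ (ofLex x).1).path (ofLex x).2
  | omega τ, x => .num (ofLex x).1 :: (τ (ofLex x).1).path (ofLex x).2
  | omegaStar τ, x =>
      .num (OrderDual.ofDual (ofLex x).1) ::
        (τ (OrderDual.ofDual (ofLex x).1)).path (ofLex x).2

theorem path_injective (τ : ChainTree) : Function.Injective τ.path := by
  induction τ with
  | zero => exact fun x => Fin.elim0 x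
  | one => exact fun x y _ => Subsingleton.elim (α := Fin 1) x y
  | plus n τ ih =>
    rintro ⟨i, x⟩ ⟨j, y⟩ h
    obtain ⟨h₁, h₂⟩ := List.cons.inj h
    obtain rfl : i = j := Fin.ext (EdgeLabel.iota.inj h₁)
    obtain rfl := ih i h₂
    rfl
  | omega τ ih =>
    rintro ⟨i, x⟩ ⟨j, y⟩ h
    obtain ⟨h₁, h₂⟩ := List.cons.inj h
    obtain rfl : i = j := EdgeLabel.num.inj h₁
    obtain rfl := ih i h₂
    rfl
  | omegaStar τ ih =>
    rintro ⟨i, x⟩ ⟨j, y⟩ h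
    obtain ⟨h₁, h₂⟩ := List.cons.inj h
    obtain rfl : i = j := EdgeLabel.num.inj h₁
    obtain rfl := ih _ h₂
    rfl

theorem mem_edgeLabels_of_mem_path (τ : ChainTree) :
    ∀ (x : τ.Chain), ∀ a ∈ τ.path x, a ∈ τ.edgeLabels := by
  induction τ with
  | zero => exact fun x => Fin.elim0 x
  | one => exact fun _ _ h => absurd h List.not_mem_nil
  | plus n τ ih =>
    rintro ⟨i, x⟩ a h
    rcases List.mem_cons.mp h with rfl | h
    · exact Or.inl ⟨i, rfl⟩
    · exact Or.inr (Set.mem_iUnion.mpr ⟨i, ih i x a h⟩)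
  | omega τ ih =>
    rintro ⟨i, x⟩ a h
    rcases List.mem_cons.mp h with rfl | h
    · exact Or.inl ⟨i, rfl⟩
    · exact Or.inr (Set.mem_iUnion.mpr ⟨i, ih i x a h⟩)
  | omegaStar τ ih =>
    rintro ⟨i, x⟩ a h
    rcases List.mem_cons.mp h with rfl | h
    · exact Or.inl ⟨OrderDual.ofDual i, rfl⟩
    · exact Or.inr (Set.mem_iUnion.mpr ⟨OrderDual.ofDual i, ih _ x a h⟩)

end ChainTree

/-- Each level of `InA` adds at most two edges: one numbered, and possibly one for a finite sum. -/
theorem InA.length_path_le {m : ℕ} {τ : ChainTree} (h : InA m τ) :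
    ∀ x : τ.Chain, (τ.path x).length ≤ 2 * m := by
  induction h with
  | zero => exact fun x => Fin.elim0 x
  | one => exact fun _ => le_rfl
  | omega m τ i hi _ _ ih =>
    rintro ⟨k, x⟩
    have h₁ := hi k
    have h₂ := ih k x
    change ((τ k).path x).length + 1 ≤ _
    omega
  | omegaStar m τ i hi _ _ ih =>
    rintro ⟨k, x⟩
    have h₁ := hi (OrderDual.ofDual k)
    have h₂ := ih (OrderDual.ofDual k) x
    change ((τ (OrderDual.ofDual k)).path x).length + 1 ≤ _
    omega
  | omegaPlus m n _ τ i hi _ _ ih =>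
    rintro ⟨k, j, x⟩
    have h₁ := hi k j
    have h₂ := ih k j x
    change ((τ k j).path x).length + 1 + 1 ≤ _
    omega
  | omegaStarPlus m n _ τ i hi _ _ ih =>
    rintro ⟨k, j, x⟩
    have h₁ := hi (OrderDual.ofDual k) j
    have h₂ := ih (OrderDual.ofDual k) j x
    change ((τ (OrderDual.ofDual k) j).path x).length + 1 + 1 ≤ _
    omega

theorem exists_length_path_le {σ : ChainTree} (h : σ ∈ treesS) :
    ∃ L, ∀ x : σ.Chain, (σ.path x).length ≤ L := by
  rcases h with ⟨m, h⟩ | ⟨n, τ, -, h, rfl⟩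
  · exact ⟨2 * m, h.length_path_le⟩
  · choose m hm using h
    refine ⟨Finset.univ.sup (fun j => 2 * m j) + 1, ?_⟩
    rintro ⟨j, x⟩
    exact Nat.succ_le_succ (((hm j).length_path_le x).trans
      (Finset.le_sup (f := fun j => 2 * m j) (Finset.mem_univ j)))

/-! ### Self-embeddings with numbers from an infinite set -/

/-- The chain of `σ` embeds into the part of the chain of `τ` formed by the leaves whose paths
carry only numbers from `M`. -/
def EmbedsWithin (M : Set ℕ) (σ τ : ChainTree) : Prop :=
  ∃ w : σ.Chain ↪o τ.Chain, ∀ x k, EdgeLabel.num k ∈ τ.path (w x) → k ∈ M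

namespace EmbedsWithin

variable {M : Set ℕ}

theorem of_embeds {ρ σ τ : ChainTree} (h : Embeds ρ.Chain σ.Chain) (h' : EmbedsWithin M σ τ) :
    EmbedsWithin M ρ τ := by
  obtain ⟨v⟩ := h
  obtain ⟨w, hw⟩ := h'
  exact ⟨v.trans w, fun x => hw (v x)⟩

theorem plus {n : ℕ} {σ τ : Fin (n + 1) → ChainTree} (h : ∀ j, EmbedsWithin M (σ j) (τ j)) :
    EmbedsWithin M (.plus n σ) (.plus n τ) := by
  choose w hw using h
  refine ⟨OrderEmbedding.sigmaLexMap (RelEmbedding.refl _) w, ?_⟩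
  rintro ⟨j, x⟩ k hk
  rcases List.mem_cons.mp hk with hk | hk
  · cases hk
  · exact hw j x k hk

theorem omega {σ τ : ℕ → ChainTree} (e : ℕ ↪o ℕ) (he : ∀ k, e k ∈ M)
    (h : ∀ k, EmbedsWithin M (σ k) (τ (e k))) : EmbedsWithin M (.omega σ) (.omega τ) := by
  choose w hw using h
  refine ⟨OrderEmbedding.sigmaLexMap e w, ?_⟩
  rintro ⟨j, x⟩ k hk
  rcases List.mem_cons.mp hk with hk | hk
  · exact EdgeLabel.num.inj hk ▸ he j
  · exact hw j x k hk

theorem omegaStar {σ τ : ℕ → ChainTree} (e : ℕ ↪o ℕ) (he : ∀ k, e k ∈ M)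
    (h : ∀ k, EmbedsWithin M (σ k) (τ (e k))) :
    EmbedsWithin M (.omegaStar σ) (.omegaStar τ) := by
  choose w hw using h
  refine ⟨OrderEmbedding.sigmaLexMap e.dual fun k => w (OrderDual.ofDual k), ?_⟩
  rintro ⟨j, x⟩ k hk
  rcases List.mem_cons.mp hk with hk | hk
  · exact EdgeLabel.num.inj hk ▸ he (OrderDual.ofDual j)
  · exact hw (OrderDual.ofDual j) x k hk

end EmbedsWithin

/-- With `e` enumerating `M` increasingly, `k ≤ e k`, so the `k`-th summand embeds into the `e
k`-th, which by induction embeds into itself within `M`. -/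
theorem InA.embedsWithin {M : Set ℕ} (hM : M.Infinite) {m : ℕ} {τ : ChainTree} (h : InA m τ) :
    EmbedsWithin M τ τ := by
  classical
  have := hM.to_subtype
  let e : ℕ ↪o ℕ := Nat.orderEmbeddingOfSet M
  have he : ∀ k, e k ∈ M := fun k => Nat.orderEmbeddingOfSet_apply (s := M) ▸ Subtype.coe_prop _
  have hle : ∀ k, k ≤ e k := fun k => e.strictMono.le_apply
  induction h with
  | zero => exact ⟨RelEmbedding.refl _, fun x => Fin.elim0 x⟩
  | one => exact ⟨RelEmbedding.refl _, fun _ _ h => absurd h List.not_mem_nil⟩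
  | omega m τ i _ _ hmono ih =>
    exact .omega e he fun k => (ih (e k)).of_embeds (embeds_of_le hmono (hle k))
  | omegaStar m τ i _ _ hmono ih =>
    exact .omegaStar e he fun k => (ih (e k)).of_embeds (embeds_of_le hmono (hle k))
  | omegaPlus m n _ τ i _ _ hmono ih =>
    exact .omega e he fun k => .plus fun j =>
      (ih (e k) j).of_embeds (embeds_of_le (τ := fun k => τ k j) (hmono j) (hle k))
  | omegaStarPlus m n _ τ i _ _ hmono ih =>
    exact .omegaStar e he fun k => .plus fun j =>
      (ih (e k) j).of_embeds (embeds_of_le (τ := fun k => τ k j) (hmono j) (hle k))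

theorem embedsWithin_of_mem_treesS {M : Set ℕ} (hM : M.Infinite) {σ : ChainTree}
    (h : σ ∈ treesS) : EmbedsWithin M σ σ := by
  rcases h with ⟨m, h⟩ | ⟨n, τ, -, h, rfl⟩
  · exact h.embedsWithin hM
  · exact .plus fun j => (h j).choose_spec.embedsWithin hM

/-! ### Patterns and the bound on colors -/

/-- A pattern of an `n`-tuple of paths of length at most `L`, in which the numbers are replaced by
their indices in an `N`-element set. -/
abbrev PathPattern (n L N w : ℕ) : Type :=
  Fin n → {l : List (Fin N ⊕ Fin (w + 1)) // l.length ≤ L}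

instance (n L N w : ℕ) : Finite (PathPattern n L N w) :=
  have : Finite {l : List (Fin N ⊕ Fin (w + 1)) // l.length ≤ L} :=
    (List.finite_length_le _ L).to_subtype
  inferInstance

/-- The tuple of paths with a given pattern and the numbers from `s`. -/
noncomputable def PathPattern.realize {n L N w : ℕ} (p : PathPattern n L N w) (s : Finset ℕ) :
    Fin n → List EdgeLabel :=
  fun i => (p i).1.map
    (Sum.elim (fun a : Fin N => .num (Nat.nth (· ∈ s) a)) fun b : Fin (w + 1) => .iota b)

theorem exists_realize_eq {n L w : ℕ} {M : Set ℕ} (hM : M.Infinite) (q : Fin n → List EdgeLabel)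
    (hlen : ∀ i, (q i).length ≤ L)
    (hq : ∀ i, ∀ a ∈ q i, a ∈ EdgeLabel.num '' M ∪ EdgeLabel.iota '' Set.Iic w) :
    ∃ (p : PathPattern n L (n * L) w) (s : Finset ℕ),
      ↑s ⊆ M ∧ s.card = n * L ∧ p.realize s = q := by
  classical
  let num? : EdgeLabel → Option ℕ := fun a => a.rec some fun _ => none
  let F : Finset ℕ := Finset.univ.biUnion fun i => ((q i).filterMap num?).toFinset
  have hF : ∀ {k}, k ∈ F ↔ ∃ i, EdgeLabel.num k ∈ q i := by
    intro k
    simp only [F, Finset.mem_biUnion, Finset.mem_univ, true_and, List.mem_toFinset,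
      List.mem_filterMap]
    refine exists_congr fun i => ⟨?_, fun h => ⟨_, h, rfl⟩⟩
    rintro ⟨a | a, h, h'⟩
    · exact Option.some.inj h' ▸ h
    · cases h'
  have hFM : ↑F ⊆ M := fun k hk => by
    obtain ⟨i, hi⟩ := hF.mp hk
    rcases hq i _ hi with ⟨_, h, h'⟩ | ⟨_, -, h⟩
    · exact EdgeLabel.num.inj h' ▸ h
    · cases h
  have hcard : F.card ≤ n * L := by
    simpa using Finset.card_biUnion_le_card_mul Finset.univ _ L fun i _ =>
      (List.toFinset_card_le _).trans ((List.length_filterMap_le _ _).trans (hlen i))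
  obtain ⟨s, hFs, hsM, hs⟩ : ∃ s : Finset ℕ, F ⊆ s ∧ ↑s ⊆ M ∧ s.card = n * L := by
    -- Ramsey's theorem needs sets of one fixed size, so `F` is padded with further elements of `M`.
    obtain ⟨u, hu, hucard⟩ := (hM.sdiff F.finite_toSet).exists_subset_card_eq (n * L - F.card)
    refine ⟨F ∪ u, Finset.subset_union_left, ?_, ?_⟩
    · rw [Finset.coe_union]
      exact Set.union_subset hFM (hu.trans Set.sdiff_subset)
    · rw [Finset.card_union_of_disjoint (Finset.disjoint_right.mpr fun x hx => (hu hx).2)]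
      omega
  have hmem : ∀ i, q i ∈ Set.range (List.map (Sum.elim
      (fun a : Fin (n * L) => EdgeLabel.num (Nat.nth (· ∈ s) a))
      fun b : Fin (w + 1) => EdgeLabel.iota b)) := by
    intro i
    rw [Set.range_list_map]
    intro a ha
    rcases hq i a ha with ⟨k, -, rfl⟩ | ⟨b, hb, rfl⟩
    · obtain ⟨j, hj, hjk⟩ := Nat.exists_lt_card_finite_nth_eq (p := (· ∈ s)) s.finite_toSet
        (hFs (hF.mpr ⟨i, ha⟩))
      refine ⟨Sum.inl ⟨j, ?_⟩, congrArg EdgeLabel.num hjk⟩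
      rw [← hs]
      convert hj
      ext; simp
    · exact ⟨Sum.inr ⟨b, Nat.lt_succ_of_le hb⟩, rfl⟩
  choose p hp using hmem
  refine ⟨fun i => ⟨p i, ?_⟩, s, hsM, hs, funext hp⟩
  rw [← List.length_map, hp]
  exact hlen i

theorem exists_forall_arrow {σ : ChainTree} (hσ : σ ∈ treesS) (hw : σ.HasBoundedFiniteSums)
    (n : ℕ) : ∃ t : ℕ, 1 ≤ t ∧ ∀ k, 2 ≤ k → Arrow σ.Chain σ.Chain (Fin n) k t := by
  classical
  obtain ⟨w, hw⟩ := hw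
  obtain ⟨L, hL⟩ := exists_length_path_le hσ
  -- The `+ 1` only serves to make the bound visibly positive.
  refine ⟨Nat.card (PathPattern n L (n * L) w) + 1, Nat.le_add_left _ _, fun k hk χ => ?_⟩
  -- The value `0` is a dummy for patterns that describe no embedding.
  let color : Finset ℕ → PathPattern n L (n * L) w → Fin k := fun s p =>
    if h : ∃ f : Fin n ↪o σ.Chain, σ.path ∘ f = p.realize s then χ h.choose else ⟨0, by omega⟩
  obtain ⟨M, -, hM, c, hc⟩ := Set.infinite_univ.exists_homogeneous (n * L) color
  obtain ⟨v, hv⟩ := embedsWithin_of_mem_treesS hM hσ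
  refine ⟨v, ?_⟩
  have hsub : (χ '' Set.range fun f : Fin n ↪o σ.Chain => f.trans v) ⊆ Set.range c := by
    rintro _ ⟨_, ⟨f, rfl⟩, rfl⟩
    obtain ⟨p, s, hs, hcard, hp⟩ := exists_realize_eq (w := w) hM
      (σ.path ∘ (f.trans v)) (fun i => hL _) fun i a ha => by
        rcases hw (σ.mem_edgeLabels_of_mem_path _ a ha) with ⟨k, rfl⟩ | h
        · exact Or.inl ⟨k, hv _ k ha, rfl⟩
        · exact Or.inr h
    have h : ∃ g : Fin n ↪o σ.Chain, σ.path ∘ g = p.realize s := ⟨f.trans v, hp.symm⟩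
    -- Paths determine elements, so the chosen embedding is the given one.
    have hg : h.choose = f.trans v := by
      refine DFunLike.coe_injective (σ.path_injective.comp_left ?_)
      exact h.choose_spec.trans hp
    refine ⟨p, ?_⟩
    rw [← hc s hs hcard]
    simp only [color, dif_pos h, hg]
  calc _ ≤ (Set.range c).encard := Set.encard_le_encard hsub
    _ ≤ (Set.univ : Set (PathPattern n L (n * L) w)).encard := by
      rw [← Set.image_univ]; exact Set.encard_image_le _ _
    _ = (Nat.card (PathPattern n L (n * L) w) : ℕ∞) := by
      rw [Set.encard_univ, ENat.card_eq_coe_natCard]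
    _ ≤ _ := by exact_mod_cast Nat.le_succ _

theorem Arrow.of_biEmbeds {C D A : Type*} [LinearOrder C] [LinearOrder D] [LinearOrder A]
    (h : BiEmbeds C D) {k t : ℕ} (hD : Arrow D D A k t) : Arrow C C A k t := by
  obtain ⟨⟨g⟩, ⟨h⟩⟩ := h
  intro χ
  obtain ⟨w, hw⟩ := hD fun f => χ (f.trans h)
  refine ⟨(g.trans w).trans h, (Set.encard_le_encard ?_).trans hw⟩
  rintro _ ⟨_, ⟨f, rfl⟩, rfl⟩
  exact ⟨_, ⟨f.trans g, rfl⟩, rfl⟩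

end ScatteredChain

theorem mainTheorem2 {S : Type*} [LinearOrder S] [Countable S]
    (hscattered : ScatteredChain.IsScattered S)
    (hrank : ScatteredChain.hausdorffRank S < ((Ordinal.omega0 : Ordinal.{0}) : WithTop Ordinal.{0}))
    (hbounded : ScatteredChain.HasBoundedFiniteSums S) :
    ScatteredChain.HasFiniteBigRamseySpectrum S := by
  obtain ⟨σ, hσ, hw, hS⟩ := hbounded
  intro n
  obtain ⟨t, ht, hr⟩ := ScatteredChain.exists_forall_arrow hσ hw n
  have key : ScatteredChain.bigRamseyDegree n S ≤ t :=
    sInf_le ⟨t, ⟨ht, fun k hk => (hr k hk).of_biEmbeds hS⟩, rfl⟩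
  exact key.trans_lt (ENat.natCast_lt_top t)
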